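/- Let $\mathcal C$ be a category with finite colimits, with coproduct $+$ and initial object $\varnothing$. Let $(\mathcal E,\mathcal M)$ be a factorisation system on $\mathcal C$: $\mathcal E$ and $\mathcal M$ are subcategories containing all isomorphisms, every morphism is of the form $m\circ e$ with $e\in\mathcal E$, $m\in\mathcal M$, and whenever $v\circ m\circ e=m'\circ e'\circ u$ with $e,e'\in\mathcal E$ and $m,m'\in\mathcal M$, there is a unique $s$ with $s\circ e=e'\circ u$ and $m'\circ s=v\circ m$. Assume that it is costable, i.e. that $\mathcal M$ is stable under pushout. A hypergraph category is a symmetric monoidal category in which each object $X$ carries a special commutative Frobenius structure $(\mu_X,\eta_X,\delta_X,\epsilon_X)$, such that the structure on $X\otimes Y$ is the one induced from those on $X$ and $Y$: $\mu_{X\otimes Y}=(\mu_X\otimes\mu_Y)\circ(1_X\otimes\sigma_{YX}\otimes 1_Y)$, $\eta_{X\otimes Y}=\eta_X\otimes\eta_Y$, $\delta_{X\otimes Y}=(1_X\otimes\sigma_{XY}\otimes 1_Y)\circ(\delta_X\otimes\delta_Y)$, $\epsilon_{X\otimes Y}=\epsilon_X\otimes\epsilon_Y$. A hypergraph functor is a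 strong symmetric monoidal functor $(F,\varphi)$ such that the Frobenius structure on each $FX$ is $(F\mu_X\circ\varphi_{X,X},\ F\eta_X\circ\varphi_1,\ \varphi_{X,X}^{-1}\circ F\delta_X,\ \varphi_1^{-1}\circ F\epsilon_X)$. It is strict if $FX\otimes FY=F(X\otimes Y)$ and $I=F(I)$ for the monoidal units $I$, and all the coherence maps $\varphi_{X,Y}$, $\varphi_1$ are identities. Let $\mathrm{Cospan}(\mathcal C)$ be the hypergraph category whose objects are those of $\mathcal C$, whose morphisms $X\to Y$ are isomorphism classes of cospans $X\to N\leftarrow Y$, with composition by pushout, monoidal product given by the coproduct of $\mathcal C$, coherence maps inherited from $(\mathcal C,+)$, and Frobenius maps $\mu=[1,1]$, $\eta=\;!$, $\delta=[1,1]^{\mathrm{op}}$, $\epsilon=\;!^{\mathrm{op}}$, where a morphism $f\colon X\to Y$ is regarded as the cospan $X\xrightarrow{f}Y\xleftarrow{1}Y$ and $f^{\mathrm{op}}$ is the cospan $Y\xrightarrow{1}Y\xleftarrow{f}X$. The $\mathcal E$-part of a cospan $X\xrightarrow{i}N\xleftarrow{o}Y$ is the cospan $X\xrightarrow{e\circ\iota_X}\overline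 N\xleftarrow{e\circ\iota_Y}Y$, where $\iota_X,\iota_Y$ are the coprojections of $X+Y$ and $[i,o]=m\circ e$ with $e\colon X+Y\to\overline N$ in $\mathcal E$ and $m\in\mathcal M$. Let $\mathrm{Corel}(\mathcal C)$ be the hypergraph category whose objects are those of $\mathcal C$, whose morphisms $X\to Y$ are isomorphism classes of $(\mathcal E,\mathcal M)$-corelations (cospans $X\xrightarrow{i}N\xleftarrow{o}Y$ with $[i,o]\in\mathcal E$), with composition given by the $\mathcal E$-part of the composite cospan, identities the $\mathcal E$-parts of the identity cospans, monoidal product that of cospans, and coherence and Frobenius maps the $\mathcal E$-parts of those of $\mathrm{Cospan}(\mathcal C)$. Then there is a strict hypergraph functor $$\square\colon \mathrm{Cospan}(\mathcal C)\longrightarrow\mathrm{Corel}(\mathcal C)$$ that takes each object to itself and each cospan to its $\mathcal E$-part. -/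

import Mathlib

open CategoryTheory Limits MonoidalCategory

universe v u

namespace CospanCorel

/-! ### Hypergraph categories and hypergraph functors -/

section Hypergraph

open scoped MonObj ComonObj

universe v₁ v₂ u₁ u₂

/-- A special commutative Frobenius monoid structure on an object `X` of a symmetric monoidal
category: a commutative monoid and a cocommutative comonoid structure on `X` satisfying the
Frobenius law and the special law. -/
class SpecialCommFrobenius {D : Type u} [Category.{v} D] [MonoidalCategory D]
    [SymmetricCategory D] (X : D) extends MonObj X, ComonObj X where
  braiding_mul : (β_ X X).hom ≫ (μ : X ⊗ X ⟶ X) = μ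
  comul_braiding : (Δ : X ⟶ X ⊗ X) ≫ (β_ X X).hom = Δ
  frobenius_left : (X ◁ (Δ : X ⟶ X ⊗ X)) ≫ (α_ X X X).inv ≫ ((μ : X ⊗ X ⟶ X) ▷ X) = μ ≫ Δ
  frobenius_right : ((Δ : X ⟶ X ⊗ X) ▷ X) ≫ (α_ X X X).hom ≫ (X ◁ (μ : X ⊗ X ⟶ X)) = μ ≫ Δ
  special : (Δ : X ⟶ X ⊗ X) ≫ (μ : X ⊗ X ⟶ X) = 𝟙 X

/-- A hypergraph category: a symmetric monoidal category in which each object is equipped with a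
special commutative Frobenius structure, compatibly with the tensor product. Here
`tensorμ X Y Z W : (X ⊗ Y) ⊗ (Z ⊗ W) ⟶ (X ⊗ Z) ⊗ (Y ⊗ W)` is the middle-four interchange
`1 ⊗ σ ⊗ 1` (with associators made explicit). -/
class HypergraphCategory (D : Type u) [Category.{v} D] [MonoidalCategory D]
    [SymmetricCategory D] where
  frobenius (X : D) : SpecialCommFrobenius X
  mul_tensor (X Y : D) :
    (frobenius (X ⊗ Y)).mul = tensorμ X Y X Y ≫ ((frobenius X).mul ⊗ₘ (frobenius Y).mul)
  one_tensor (X Y : D) :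
    (frobenius (X ⊗ Y)).one = (λ_ (𝟙_ D)).inv ≫ ((frobenius X).one ⊗ₘ (frobenius Y).one)
  comul_tensor (X Y : D) :
    (frobenius (X ⊗ Y)).comul = ((frobenius X).comul ⊗ₘ (frobenius Y).comul) ≫ tensorμ X X Y Y
  counit_tensor (X Y : D) :
    (frobenius (X ⊗ Y)).counit = ((frobenius X).counit ⊗ₘ (frobenius Y).counit) ≫ (λ_ (𝟙_ D)).hom

variable {D : Type u₁} [Category.{v₁} D] [MonoidalCategory D] [SymmetricCategory D]
  [HypergraphCategory D]
  {D' : Type u₂} [Category.{v₂} D'] [MonoidalCategory D'] [SymmetricCategory D']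
  [HypergraphCategory D']

open HypergraphCategory in
/-- A strong symmetric monoidal functor between hypergraph categories (the symmetric monoidal
structure, with its coherence maps, is the instance `F.Braided`) is a hypergraph functor if the
Frobenius structure of each `F X` is the image of that of `X`, transported along the
coherence maps. -/
structure IsHypergraphFunctor (F : D ⥤ D') [F.Braided] : Prop where
  mul (X : D) : (frobenius (F.obj X)).mul =
    Functor.LaxMonoidal.μ F X X ≫ F.map (frobenius X).mul
  one (X : D) : (frobenius (F.obj X)).one =
    Functor.LaxMonoidal.ε F ≫ F.map (frobenius X).one
  comul (X : D) : (frobenius (F.obj X)).comul =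
    F.map (frobenius X).comul ≫ Functor.OplaxMonoidal.δ F X X
  counit (X : D) : (frobenius (F.obj X)).counit =
    F.map (frobenius X).counit ≫ Functor.OplaxMonoidal.η F

/-- A hypergraph functor is strict if it preserves the monoidal unit and the tensor product of
objects on the nose, and its coherence maps are identities. -/
structure IsStrictHypergraphFunctor (F : D ⥤ D') [F.Braided] : Prop
    extends IsHypergraphFunctor F where
  unit_strict : ∃ h : 𝟙_ D' = F.obj (𝟙_ D), Functor.LaxMonoidal.ε F = eqToHom h
  tensor_strict (X Y : D) : ∃ h : F.obj X ⊗ F.obj Y = F.obj (X ⊗ Y),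
    Functor.LaxMonoidal.μ F X Y = eqToHom h

end Hypergraph

noncomputable section

set_option linter.unusedSectionVars false

variable {C : Type u} [Category.{v} C]

/-! ### Cospans -/

/-- A cospan from `X` to `Y`. -/
structure Cospan (X Y : C) where
  apex : C
  left : X ⟶ apex
  right : Y ⟶ apex

/-- An isomorphism of cospans: an isomorphism of apices which commutes with the legs. -/
def Cospan.IsIsomorphic {X Y : C} (c d : Cospan X Y) : Prop :=
  ∃ e : c.apex ≅ d.apex, c.left ≫ e.hom = d.left ∧ c.right ≫ e.hom = d.right

instance Cospan.setoid (X Y : C) : Setoid (Cospan X Y) where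
  r := Cospan.IsIsomorphic
  iseqv :=
    { refl := fun c => ⟨Iso.refl _, by simp, by simp⟩
      symm := by
        rintro c d ⟨e, h₁, h₂⟩
        exact ⟨e.symm, by simp [← h₁], by simp [← h₂]⟩
      trans := by
        rintro c d k ⟨e, h₁, h₂⟩ ⟨e', h₁', h₂'⟩
        exact ⟨e ≪≫ e', by simp [← h₁', ← h₁], by simp [← h₂', ← h₂]⟩ }

/-- Isomorphism classes of cospans from `X` to `Y`. -/
def CospanClass (X Y : C) := Quotient (Cospan.setoid X Y)

namespace CospanClass

attribute [local simp] coprod.inl_desc coprod.inl_desc_assoc coprod.inr_desc coprod.inr_desc_assoc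
  pushout.inl_desc pushout.inl_desc_assoc pushout.inr_desc pushout.inr_desc_assoc

/-- The class of the cospan `X ⟶ N ⟵ Y`. -/
def mk {X Y N : C} (i : X ⟶ N) (o : Y ⟶ N) : CospanClass X Y :=
  Quotient.mk _ ⟨N, i, o⟩

theorem mk_eq {X Y N N' : C} {i : X ⟶ N} {o : Y ⟶ N} {i' : X ⟶ N'} {o' : Y ⟶ N'}
    (e : N ≅ N') (h₁ : i ≫ e.hom = i') (h₂ : o ≫ e.hom = o') : mk i o = mk i' o' :=
  Quotient.sound ⟨e, h₁, h₂⟩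

@[elab_as_elim]
theorem ind {X Y : C} {P : CospanClass X Y → Prop}
    (h : ∀ (N : C) (i : X ⟶ N) (o : Y ⟶ N), P (mk i o)) (a : CospanClass X Y) : P a :=
  Quotient.ind (fun c => h c.apex c.left c.right) a

variable [HasFiniteColimits C]

/-- Composition of cospans by pushout over the common foot. -/
def comp {X Y Z : C} : CospanClass X Y → CospanClass Y Z → CospanClass X Z :=
  Quotient.lift₂
    (fun c d => mk (c.left ≫ pushout.inl c.right d.left) (d.right ≫ pushout.inr c.right d.left))
    (by
      rintro c d c' d' ⟨e, h₁, h₂⟩ ⟨e', h₁', h₂'⟩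
      refine mk_eq (asIso (pushout.map c.right d.left c'.right d'.left e.hom e'.hom (𝟙 Y)
        (by simpa using h₂) (by simpa using h₁'))) ?_ ?_
      · simp [← h₁, pushout.map]
      · simp [← h₂', pushout.map])

theorem comp_mk {X Y Z N M P : C} {i : X ⟶ N} {o : Y ⟶ N} {i' : Y ⟶ M} {o' : Z ⟶ M}
    {j : N ⟶ P} {k : M ⟶ P} (h : IsPushout o i' j k) :
    comp (mk i o) (mk i' o') = mk (i ≫ j) (o' ≫ k) :=
  mk_eq h.isoPushout.symm (by simp) (by simp)

/-- The monoidal product of cospans, induced by the coproduct of `C`. -/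
def tensor {X Y X' Y' : C} : CospanClass X Y → CospanClass X' Y' →
    CospanClass (X ⨿ X') (Y ⨿ Y') :=
  Quotient.lift₂
    (fun c d => mk (coprod.map c.left d.left) (coprod.map c.right d.right))
    (by
      rintro c d c' d' ⟨e, h₁, h₂⟩ ⟨e', h₁', h₂'⟩
      exact mk_eq (coprod.mapIso e e') (by simp [← h₁, ← h₁']) (by simp [← h₂, ← h₂']))

theorem tensor_mk {X Y X' Y' N M : C} (i : X ⟶ N) (o : Y ⟶ N) (i' : X' ⟶ M) (o' : Y' ⟶ M) :
    tensor (mk i o) (mk i' o') = mk (coprod.map i i') (coprod.map o o') := rfl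

/-- The cospan `X ⟶ Y ⟵ Y` given by a morphism `f : X ⟶ Y` and the identity. -/
def fwd {X Y : C} (f : X ⟶ Y) : CospanClass X Y := mk f (𝟙 Y)

/-- The cospan `Y ⟶ Y ⟵ X` given by the identity and a morphism `f : X ⟶ Y`. -/
def bwd {X Y : C} (f : X ⟶ Y) : CospanClass Y X := mk (𝟙 Y) f

theorem fwd_comp_mk {X Y Z N : C} (f : X ⟶ Y) (i : Y ⟶ N) (o : Z ⟶ N) :
    comp (fwd f) (mk i o) = mk (f ≫ i) o := by
  have h : IsPushout (𝟙 Y) i i (𝟙 N) := IsPushout.of_id_fst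
  simpa [fwd] using comp_mk (i := f) (o' := o) h

theorem mk_comp_bwd {X Y Z N : C} (i : X ⟶ N) (o : Y ⟶ N) (f : Z ⟶ Y) :
    comp (mk i o) (bwd f) = mk i (f ≫ o) := by
  have h : IsPushout o (𝟙 Y) (𝟙 N) o := IsPushout.of_id_snd
  simpa [bwd] using comp_mk (i := i) (o' := f) h


theorem mk_eq_bwd {X Y N : C} (i : X ⟶ N) (o : Y ⟶ N) : mk i o = comp (fwd i) (bwd o) := by
  simp [bwd, fwd_comp_mk]

theorem mk_comp_fwd_iso {X Y Z N : C} (i : X ⟶ N) (o : Y ⟶ N) (e : Y ≅ Z) :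
    comp (mk i o) (fwd e.hom) = mk i (e.inv ≫ o) := by
  have h : IsPushout o e.hom (𝟙 N) (e.inv ≫ o) := IsPushout.of_vert_isIso ⟨by simp⟩
  simpa [fwd] using comp_mk (i := i) (o' := 𝟙 Z) h

theorem fwd_comp {X Y Z : C} (f : X ⟶ Y) (g : Y ⟶ Z) :
    comp (fwd f) (fwd g) = fwd (f ≫ g) := fwd_comp_mk f g (𝟙 Z)

theorem bwd_comp {X Y Z : C} (f : X ⟶ Y) (g : Y ⟶ Z) :
    comp (bwd g) (bwd f) = bwd (f ≫ g) := mk_comp_bwd (𝟙 Z) g f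

theorem bwd_comp_fwd {X Y Z P : C} {f : X ⟶ Y} {g : X ⟶ Z} {j : Y ⟶ P} {k : Z ⟶ P}
    (h : IsPushout f g j k) : comp (bwd f) (fwd g) = mk j k := by
  simpa [bwd, fwd] using comp_mk (i := 𝟙 Y) (o' := 𝟙 Z) h

theorem fwd_eq_bwd {X Y : C} (e : X ≅ Y) : fwd e.hom = bwd e.inv :=
  mk_eq e.symm (by simp) (by simp)

theorem bwd_eq_fwd {X Y : C} (e : X ≅ Y) : bwd e.hom = fwd e.inv :=
  mk_eq e.symm (by simp) (by simp)

theorem fwd_tensor {X Y X' Y' : C} (f : X ⟶ Y) (g : X' ⟶ Y') :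
    tensor (fwd f) (fwd g) = fwd (coprod.map f g) := by
  simp [fwd, tensor_mk]

theorem bwd_tensor {X Y X' Y' : C} (f : X ⟶ Y) (g : X' ⟶ Y') :
    tensor (bwd f) (bwd g) = bwd (coprod.map f g) := by
  simp [bwd, tensor_mk]

theorem id_comp {X Y : C} (a : CospanClass X Y) : comp (fwd (𝟙 X)) a = a := by
  induction a using ind with
  | h N i o => simp [fwd_comp_mk]

theorem comp_id {X Y : C} (a : CospanClass X Y) : comp a (fwd (𝟙 Y)) = a := by
  induction a using ind with
  | h N i o => simpa using mk_comp_fwd_iso i o (Iso.refl Y)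

theorem assoc {X Y Z W : C} (a : CospanClass X Y) (b : CospanClass Y Z) (c : CospanClass Z W) :
    comp (comp a b) c = comp a (comp b c) := by
  induction a using ind with
  | h N i o =>
  induction b using ind with
  | h M i' o' =>
  induction c using ind with
  | h P i'' o'' =>
  have h₁ := IsPushout.of_hasPushout o i'
  have h₂ := IsPushout.of_hasPushout o' i''
  have h₃ := IsPushout.of_hasPushout (pushout.inr o i') (pushout.inl o' i'')
  rw [comp_mk h₁, comp_mk h₂, comp_mk (h₂.flip.paste_vert h₃.flip).flip,
    comp_mk (h₁.paste_vert h₃)]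
  simp

/-- A coproduct of two pushout squares is a pushout square. -/
theorem isPushout_coprod {A B D P A' B' D' P' : C} {f : A ⟶ B} {g : A ⟶ D} {j : B ⟶ P}
    {k : D ⟶ P} {f' : A' ⟶ B'} {g' : A' ⟶ D'} {j' : B' ⟶ P'} {k' : D' ⟶ P'}
    (h : IsPushout f g j k) (h' : IsPushout f' g' j' k') :
    IsPushout (coprod.map f f') (coprod.map g g') (coprod.map j j') (coprod.map k k') := by
  refine ⟨⟨by simp [h.w, h'.w]⟩, ⟨PushoutCocone.IsColimit.mk _ (fun s => coprod.desc
    (h.desc (coprod.inl ≫ s.inl) (coprod.inl ≫ s.inr)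
      (by simpa using coprod.inl ≫= s.condition))
    (h'.desc (coprod.inr ≫ s.inl) (coprod.inr ≫ s.inr)
      (by simpa using coprod.inr ≫= s.condition))) ?_ ?_ ?_⟩⟩
  · intro s
    ext <;> simp
  · intro s
    ext <;> simp
  · intro s m hm₁ hm₂
    ext
    · apply h.hom_ext
      · simp [← hm₁]
      · simp [← hm₂]
    · apply h'.hom_ext
      · simp [← hm₁]
      · simp [← hm₂]

theorem tensor_comp {X Y Z X' Y' Z' : C} (a : CospanClass X Y) (b : CospanClass Y Z)
    (a' : CospanClass X' Y') (b' : CospanClass Y' Z') :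
    comp (tensor a a') (tensor b b') = tensor (comp a b) (comp a' b') := by
  induction a using ind with
  | h N i o =>
  induction b using ind with
  | h M i₁ o₁ =>
  induction a' using ind with
  | h N' i' o' =>
  induction b' using ind with
  | h M' i₁' o₁' =>
  have h := IsPushout.of_hasPushout o i₁
  have h' := IsPushout.of_hasPushout o' i₁'
  rw [tensor_mk, tensor_mk, comp_mk (isPushout_coprod h h'), comp_mk h, comp_mk h', tensor_mk]
  simp

/-- Naturality with respect to isomorphisms of `C`, for the classes of cospans given by them. -/
theorem mk_comp_fwd_iso_eq {X Y X' Y' N N' : C} (i : X ⟶ N) (o : Y ⟶ N) (i' : X' ⟶ N')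
    (o' : Y' ⟶ N') (e : X ≅ X') (e' : Y ≅ Y') (n : N ≅ N') (hi : i ≫ n.hom = e.hom ≫ i')
    (ho : o ≫ n.hom = e'.hom ≫ o') :
    comp (mk i o) (fwd e'.hom) = comp (fwd e.hom) (mk i' o') := by
  rw [mk_comp_fwd_iso, fwd_comp_mk]
  exact mk_eq n hi (by simp [ho])

theorem isPushout_codiag (X : C) :
    IsPushout (coprod.desc (𝟙 X) (𝟙 X)) (coprod.desc (𝟙 X) (𝟙 X)) (𝟙 X) (𝟙 X) := by
  refine ⟨⟨rfl⟩, ⟨PushoutCocone.IsColimit.mk _ (fun s => s.inl) (by simp) ?_ ?_⟩⟩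
  · intro s
    simpa using coprod.inl ≫= s.condition
  · intro s m hm₁ _
    simpa using hm₁

theorem isPushout_frobenius (X : C) :
    IsPushout (coprod.map (coprod.desc (𝟙 X) (𝟙 X)) (𝟙 X))
      ((coprod.associator X X X).hom ≫ coprod.map (𝟙 X) (coprod.desc (𝟙 X) (𝟙 X)))
      (coprod.desc (𝟙 X) (𝟙 X)) (coprod.desc (𝟙 X) (𝟙 X)) := by
  refine ⟨⟨by ext <;> simp⟩,
    ⟨PushoutCocone.IsColimit.mk _ (fun s => coprod.inl ≫ s.inl) ?_ ?_ ?_⟩⟩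
  · intro s
    have h₁ := coprod.inl ≫= coprod.inr ≫= (coprod.associator X X X).inv ≫= s.condition
    have h₂ := coprod.inr ≫= coprod.inr ≫= (coprod.associator X X X).inv ≫= s.condition
    simp at h₁ h₂
    ext
    · simp
    · simp [h₁, h₂]
  · intro s
    have h₀ := coprod.inl ≫= (coprod.associator X X X).inv ≫= s.condition
    have h₁ := coprod.inl ≫= coprod.inr ≫= (coprod.associator X X X).inv ≫= s.condition
    simp at h₀ h₁
    ext
    · simp [h₀]
    · simp [h₁]
  · intro s m hm₁ _
    simp [← hm₁]

theorem isPushout_frobenius' (X : C) :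
    IsPushout (coprod.map (𝟙 X) (coprod.desc (𝟙 X) (𝟙 X)))
      ((coprod.associator X X X).inv ≫ coprod.map (coprod.desc (𝟙 X) (𝟙 X)) (𝟙 X))
      (coprod.desc (𝟙 X) (𝟙 X)) (coprod.desc (𝟙 X) (𝟙 X)) := by
  have h := (isPushout_frobenius X).flip
  refine h.of_iso (coprod.associator X X X) (Iso.refl _) (Iso.refl _) (Iso.refl _) ?_ ?_ ?_ ?_
  · simp
  · ext <;> simp
  · simp
  · simp

end CospanClass

/-! ### The hypergraph category of cospans -/

/-- The objects of the category of cospans in `C`: the objects of `C`. -/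
@[ext]
structure CospanCat (C : Type u) where
  of ::
  as : C

namespace CospanCat

open CospanClass

variable [HasFiniteColimits C]

attribute [local simp] coprod.inl_desc coprod.inl_desc_assoc coprod.inr_desc coprod.inr_desc_assoc

instance : Category.{max u v} (CospanCat C) where
  Hom X Y := CospanClass X.as Y.as
  id X := fwd (𝟙 X.as)
  comp a b := comp a b
  id_comp := CospanClass.id_comp
  comp_id := CospanClass.comp_id
  assoc := CospanClass.assoc

/-- The isomorphism in the category of cospans given by an isomorphism of `C`. -/
def fwdIso {X Y : C} (e : X ≅ Y) : of X ≅ of Y where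
  hom := fwd e.hom
  inv := fwd e.inv
  hom_inv_id := (fwd_comp e.hom e.inv).trans (by rw [e.hom_inv_id]; rfl)
  inv_hom_id := (fwd_comp e.inv e.hom).trans (by rw [e.inv_hom_id]; rfl)

instance : MonoidalCategoryStruct (CospanCat C) where
  tensorObj X Y := of (X.as ⨿ Y.as)
  whiskerLeft X _ _ a := tensor (fwd (𝟙 X.as)) a
  whiskerRight a Y := tensor a (fwd (𝟙 Y.as))
  tensorHom a b := tensor a b
  tensorUnit := of (⊥_ C)
  associator X Y Z := fwdIso (coprod.associator X.as Y.as Z.as)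
  leftUnitor X := fwdIso (coprod.leftUnitor X.as)
  rightUnitor X := fwdIso (coprod.rightUnitor X.as)

instance : MonoidalCategory (CospanCat C) :=
  MonoidalCategory.ofTensorHom
    (id_tensorHom_id := fun X Y =>
      (fwd_tensor (𝟙 X.as) (𝟙 Y.as)).trans (by rw [coprod.map_id_id]; rfl))
    (id_tensorHom := fun _ _ _ _ => rfl)
    (tensorHom_id := fun _ _ => rfl)
    (tensorHom_comp_tensorHom := fun a a' b b' => tensor_comp a b a' b')
    (associator_naturality := by
      intro X₁ X₂ X₃ Y₁ Y₂ Y₃ a b c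
      induction a using ind with
      | h N i o =>
      induction b using ind with
      | h N' i' o' =>
      induction c using ind with
      | h N'' i'' o'' =>
      exact mk_comp_fwd_iso_eq _ _ _ _ (coprod.associator _ _ _) (coprod.associator _ _ _)
        (coprod.associator N N' N'') (coprod.associator_naturality _ _ _)
        (coprod.associator_naturality _ _ _))
    (leftUnitor_naturality := by
      intro X Y a
      induction a using ind with
      | h N i o =>
      exact mk_comp_fwd_iso_eq _ _ _ _ (coprod.leftUnitor _) (coprod.leftUnitor _)
        (coprod.leftUnitor N) (coprod.leftUnitor_naturality _) (coprod.leftUnitor_naturality _))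
    (rightUnitor_naturality := by
      intro X Y a
      induction a using ind with
      | h N i o =>
      exact mk_comp_fwd_iso_eq _ _ _ _ (coprod.rightUnitor _) (coprod.rightUnitor _)
        (coprod.rightUnitor N) (coprod.rightUnitor_naturality _)
        (coprod.rightUnitor_naturality _))
    (pentagon := by
      intro W X Y Z
      change comp (tensor (fwd _) (fwd _)) (comp (fwd _) (tensor (fwd _) (fwd _))) =
        comp (fwd _) (fwd _)
      simp only [fwd_tensor, fwd_comp]
      exact congrArg fwd (coprod.pentagon W.as X.as Y.as Z.as))
    (triangle := by
      intro X Y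
      change comp (fwd _) (tensor (fwd _) (fwd _)) = tensor (fwd _) (fwd _)
      simp only [fwd_tensor, fwd_comp]
      exact congrArg fwd (coprod.triangle X.as Y.as))

theorem braiding_naturality {X X' Y Y' : C} (a : CospanClass X Y) (b : CospanClass X' Y') :
    comp (tensor a b) (fwd (coprod.braiding Y Y').hom) =
      comp (fwd (coprod.braiding X X').hom) (tensor b a) := by
  induction a using ind with
  | h N i o =>
  induction b using ind with
  | h N' i' o' =>
  exact mk_comp_fwd_iso_eq _ _ _ _ (coprod.braiding _ _) (coprod.braiding _ _)
    (coprod.braiding N N') (by simp) (by simp)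

instance : SymmetricCategory (CospanCat C) where
  braiding X Y := fwdIso (coprod.braiding X.as Y.as)
  braiding_naturality_right X _ _ f := braiding_naturality (fwd (𝟙 X.as)) f
  braiding_naturality_left f Z := braiding_naturality f (fwd (𝟙 Z.as))
  hexagon_forward X Y Z := by
    change comp (fwd _) (comp (fwd _) (fwd _)) =
      comp (tensor (fwd _) (fwd _)) (comp (fwd _) (tensor (fwd _) (fwd _)))
    simp only [fwd_tensor, fwd_comp]
    refine congrArg fwd ?_
    change (coprod.associator X.as Y.as Z.as).hom ≫ (coprod.braiding X.as (Y.as ⨿ Z.as)).hom ≫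
      (coprod.associator Y.as Z.as X.as).hom = coprod.map (coprod.braiding X.as Y.as).hom (𝟙 Z.as) ≫
      (coprod.associator Y.as X.as Z.as).hom ≫
      coprod.map (𝟙 Y.as) (coprod.braiding X.as Z.as).hom
    ext <;> simp
  hexagon_reverse X Y Z := by
    change comp (fwd _) (comp (fwd _) (fwd _)) =
      comp (tensor (fwd _) (fwd _)) (comp (fwd _) (tensor (fwd _) (fwd _)))
    simp only [fwd_tensor, fwd_comp]
    refine congrArg fwd ?_
    change (coprod.associator X.as Y.as Z.as).inv ≫ (coprod.braiding (X.as ⨿ Y.as) Z.as).hom ≫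
      (coprod.associator Z.as X.as Y.as).inv = coprod.map (𝟙 X.as) (coprod.braiding Y.as Z.as).hom ≫
      (coprod.associator X.as Z.as Y.as).inv ≫
      coprod.map (coprod.braiding X.as Z.as).hom (𝟙 Y.as)
    ext <;> simp
  symmetry X Y := (fwd_comp _ _).trans (by
    refine congrArg fwd ?_
    exact coprod.symmetry X.as Y.as)

/-- The fold map `[1, 1] : X + X ⟶ X`. -/
abbrev fold (X : C) : X ⨿ X ⟶ X := coprod.desc (𝟙 X) (𝟙 X)

/-- The Frobenius structure on an object of the category of cospans: the multiplication and the
unit are the cospans given by `[1, 1] : X + X ⟶ X` and `! : ∅ ⟶ X`, the comultiplication and the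
counit are their opposites. -/
abbrev frobenius (X : CospanCat C) : SpecialCommFrobenius X where
  mul := fwd (fold X.as)
  one := fwd (initial.to X.as)
  comul := bwd (fold X.as)
  counit := bwd (initial.to X.as)
  one_mul := by
    change comp (tensor (fwd _) (fwd _)) (fwd _) = fwd _
    rw [fwd_tensor, fwd_comp]
    refine congrArg fwd ?_
    simp
    rfl
  mul_one := by
    change comp (tensor (fwd _) (fwd _)) (fwd _) = fwd _
    rw [fwd_tensor, fwd_comp]
    refine congrArg fwd ?_
    simp
    rfl
  mul_assoc := by
    change comp (tensor (fwd _) (fwd _)) (fwd _) =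
      comp (fwd _) (comp (tensor (fwd _) (fwd _)) (fwd _))
    simp only [fwd_tensor, fwd_comp]
    refine congrArg fwd ?_
    ext <;> simp
  counit_comul := by
    change comp (bwd _) (tensor (bwd _) (bwd (𝟙 X.as))) = fwd (coprod.leftUnitor X.as).inv
    rw [bwd_tensor, bwd_comp, ← bwd_eq_fwd]
    refine congrArg bwd ?_
    simp
  comul_counit := by
    change comp (bwd _) (tensor (bwd (𝟙 X.as)) (bwd _)) = fwd (coprod.rightUnitor X.as).inv
    rw [bwd_tensor, bwd_comp, ← bwd_eq_fwd]
    refine congrArg bwd ?_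
    simp
  comul_assoc := by
    change comp (bwd _) (tensor (bwd (𝟙 X.as)) (bwd _)) =
      comp (bwd _) (comp (tensor (bwd _) (bwd (𝟙 X.as)))
        (fwd (coprod.associator X.as X.as X.as).hom))
    simp only [fwd_eq_bwd, bwd_tensor, bwd_comp]
    refine congrArg bwd ?_
    ext <;> simp
  braiding_mul := by
    change comp (fwd (coprod.braiding _ _).hom) (fwd _) = fwd _
    rw [fwd_comp]
    refine congrArg fwd ?_
    ext <;> simp
  comul_braiding := by
    change comp (bwd _) (fwd (coprod.braiding X.as X.as).hom) = bwd _
    rw [fwd_eq_bwd, bwd_comp]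
    refine congrArg bwd ?_
    ext <;> simp
  frobenius_left := by
    change comp (tensor (bwd (𝟙 X.as)) (bwd _)) (comp (fwd (coprod.associator X.as X.as X.as).inv)
      (tensor (fwd _) (fwd (𝟙 X.as)))) = comp (fwd _) (bwd _)
    rw [bwd_tensor, fwd_tensor, fwd_comp, bwd_comp_fwd (isPushout_frobenius' X.as), ← mk_eq_bwd]
  frobenius_right := by
    change comp (tensor (bwd _) (bwd (𝟙 X.as))) (comp (fwd (coprod.associator X.as X.as X.as).hom)
      (tensor (fwd (𝟙 X.as)) (fwd _))) = comp (fwd _) (bwd _)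
    rw [bwd_tensor, fwd_tensor, fwd_comp, bwd_comp_fwd (isPushout_frobenius X.as), ← mk_eq_bwd]
  special := by
    change comp (bwd _) (fwd _) = fwd (𝟙 _)
    rw [bwd_comp_fwd (isPushout_codiag X.as)]
    rfl

theorem tensorμ_eq (X Y Z W : CospanCat C) :
    tensorμ X Y Z W = fwd ((coprod.associator X.as Y.as (Z.as ⨿ W.as)).hom ≫
      coprod.map (𝟙 X.as) (coprod.associator Y.as Z.as W.as).inv ≫
      coprod.map (𝟙 X.as) (coprod.map (coprod.braiding Y.as Z.as).hom (𝟙 W.as)) ≫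
      coprod.map (𝟙 X.as) (coprod.associator Z.as Y.as W.as).hom ≫
      (coprod.associator X.as Z.as (Y.as ⨿ W.as)).inv) := by
  simp only [← fwd_comp, ← fwd_tensor]
  rfl

theorem tensorμ_eq_bwd (X Y Z W : CospanCat C) :
    tensorμ X Y Z W = bwd ((coprod.associator X.as Z.as (Y.as ⨿ W.as)).hom ≫
      coprod.map (𝟙 X.as) (coprod.associator Z.as Y.as W.as).inv ≫
      coprod.map (𝟙 X.as) (coprod.map (coprod.braiding Y.as Z.as).inv (𝟙 W.as)) ≫
      coprod.map (𝟙 X.as) (coprod.associator Y.as Z.as W.as).hom ≫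
      (coprod.associator X.as Y.as (Z.as ⨿ W.as)).inv) := by
  simp only [← bwd_comp, ← bwd_tensor, bwd_eq_fwd, ← fwd_eq_bwd, CospanClass.assoc]
  rfl

instance : HypergraphCategory (CospanCat C) where
  frobenius := frobenius
  mul_tensor X Y := by
    rw [tensorμ_eq]
    change fwd (fold (X.as ⨿ Y.as)) = comp (fwd _) (tensor (fwd (fold X.as)) (fwd (fold Y.as)))
    rw [fwd_tensor, fwd_comp]
    refine congrArg fwd ?_
    ext <;> simp
  one_tensor X Y := by
    change fwd (initial.to (X.as ⨿ Y.as)) = comp (fwd (coprod.leftUnitor (⊥_ C)).inv)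
      (tensor (fwd (initial.to X.as)) (fwd (initial.to Y.as)))
    rw [fwd_tensor, fwd_comp]
    refine congrArg fwd ?_
    exact Subsingleton.elim _ _
  comul_tensor X Y := by
    rw [tensorμ_eq_bwd]
    change bwd (fold (X.as ⨿ Y.as)) = comp (tensor (bwd (fold X.as)) (bwd (fold Y.as))) (bwd _)
    rw [bwd_tensor, bwd_comp]
    refine congrArg bwd ?_
    ext <;> simp
  counit_tensor X Y := by
    change bwd (initial.to (X.as ⨿ Y.as)) = comp (tensor (bwd (initial.to X.as))
      (bwd (initial.to Y.as))) (fwd (coprod.leftUnitor (⊥_ C)).hom)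
    rw [fwd_eq_bwd, bwd_tensor, bwd_comp]
    refine congrArg bwd ?_
    exact Subsingleton.elim _ _

end CospanCat

/-! ### Factorisation systems and corelations -/

/-- A factorisation system `(E, M)` on `C`. -/
structure FactorisationSystem (C : Type u) [Category.{v} C] where
  E : MorphismProperty C
  M : MorphismProperty C
  E_comp {X Y Z : C} (f : X ⟶ Y) (g : Y ⟶ Z) : E f → E g → E (f ≫ g)
  M_comp {X Y Z : C} (f : X ⟶ Y) (g : Y ⟶ Z) : M f → M g → M (f ≫ g)
  E_iso {X Y : C} (f : X ⟶ Y) [IsIso f] : E f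
  M_iso {X Y : C} (f : X ⟶ Y) [IsIso f] : M f
  factorisation {X Y : C} (f : X ⟶ Y) :
    ∃ (Z : C) (e : X ⟶ Z) (m : Z ⟶ Y), E e ∧ M m ∧ e ≫ m = f
  unique_diagonal {X Y Z X' Y' Z' : C} (e : X ⟶ Z) (m : Z ⟶ Y) (e' : X' ⟶ Z') (m' : Z' ⟶ Y')
    (u : X ⟶ X') (v : Y ⟶ Y') : E e → M m → E e' → M m' →
    (e ≫ m) ≫ v = u ≫ e' ≫ m' → ∃! s : Z ⟶ Z', e ≫ s = u ≫ e' ∧ m ≫ v = s ≫ m'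

/-- A factorisation system `(E, M)` is costable if `M` is stable under pushout. -/
structure CostableFactorisationSystem (C : Type u) [Category.{v} C]
    extends FactorisationSystem C where
  costable : M.IsStableUnderCobaseChange

namespace FactorisationSystem

variable (S : FactorisationSystem C)

/-- The middle object of a chosen factorisation of `f`. -/
def mid {X Y : C} (f : X ⟶ Y) : C := (S.factorisation f).choose

/-- The `E`-factor of `f`. -/
def eFactor {X Y : C} (f : X ⟶ Y) : X ⟶ S.mid f := (S.factorisation f).choose_spec.choose

/-- The `M`-factor of `f`. -/
def mFactor {X Y : C} (f : X ⟶ Y) : S.mid f ⟶ Y :=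
  (S.factorisation f).choose_spec.choose_spec.choose

theorem eFactor_mem {X Y : C} (f : X ⟶ Y) : S.E (S.eFactor f) :=
  (S.factorisation f).choose_spec.choose_spec.choose_spec.1

theorem mFactor_mem {X Y : C} (f : X ⟶ Y) : S.M (S.mFactor f) :=
  (S.factorisation f).choose_spec.choose_spec.choose_spec.2.1

theorem eFactor_comp_mFactor {X Y : C} (f : X ⟶ Y) : S.eFactor f ≫ S.mFactor f = f :=
  (S.factorisation f).choose_spec.choose_spec.choose_spec.2.2

theorem factorisation_iso {X Y Z Z' : C} {e : X ⟶ Z} {m : Z ⟶ Y} {e' : X ⟶ Z'} {m' : Z' ⟶ Y}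
    (he : S.E e) (hm : S.M m) (he' : S.E e') (hm' : S.M m') (h : e ≫ m = e' ≫ m') :
    ∃ n : Z ≅ Z', e ≫ n.hom = e' := by
  obtain ⟨s, ⟨hs₁, hs₂⟩, -⟩ := S.unique_diagonal e m e' m' (𝟙 X) (𝟙 Y) he hm he' hm' (by simp [h])
  obtain ⟨t, ⟨ht₁, ht₂⟩, -⟩ := S.unique_diagonal e' m' e m (𝟙 X) (𝟙 Y) he' hm' he hm (by simp [h])
  simp only [Category.id_comp, Category.comp_id] at hs₁ hs₂ ht₁ ht₂
  refine ⟨⟨s, t, ?_, ?_⟩, hs₁⟩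
  · obtain ⟨w, -, hw⟩ := S.unique_diagonal e m e m (𝟙 X) (𝟙 Y) he hm he hm (by simp)
    rw [hw (s ≫ t) ⟨by simp [reassoc_of% hs₁, ht₁], by simp [← ht₂, ← hs₂]⟩,
      hw (𝟙 Z) ⟨by simp, by simp⟩]
  · obtain ⟨w, -, hw⟩ := S.unique_diagonal e' m' e' m' (𝟙 X) (𝟙 Y) he' hm' he' hm' (by simp)
    rw [hw (t ≫ s) ⟨by simp [reassoc_of% ht₁, hs₁], by simp [← ht₂, ← hs₂]⟩,
      hw (𝟙 Z') ⟨by simp, by simp⟩]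

variable [HasFiniteColimits C]

attribute [local simp] coprod.inl_desc coprod.inl_desc_assoc coprod.inr_desc coprod.inr_desc_assoc

theorem E_coprod {A B A' B' : C} {f : A ⟶ B} {g : A' ⟶ B'} (hf : S.E f) (hg : S.E g) :
    S.E (coprod.map f g) := by
  have he := S.eFactor_mem (coprod.map f g)
  have hm := S.mFactor_mem (coprod.map f g)
  have hfac := S.eFactor_comp_mFactor (coprod.map f g)
  set e := S.eFactor (coprod.map f g)
  set m := S.mFactor (coprod.map f g)
  obtain ⟨x, ⟨hx₁, hx₂⟩, -⟩ := S.unique_diagonal f (𝟙 B) e m coprod.inl coprod.inl hf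
    (S.M_iso _) he hm (by simp [hfac])
  obtain ⟨y, ⟨hy₁, hy₂⟩, -⟩ := S.unique_diagonal g (𝟙 B') e m coprod.inr coprod.inr hg
    (S.M_iso _) he hm (by simp [hfac])
  simp only [Category.id_comp] at hx₂ hy₂
  have h₁ : coprod.desc x y ≫ m = 𝟙 _ := by
    ext <;> simp [← hx₂, ← hy₂]
  have h₂ : coprod.map f g ≫ coprod.desc x y = e := by
    ext <;> simp [hx₁, hy₁]
  have h₃ : m ≫ coprod.desc x y = 𝟙 _ := by
    obtain ⟨w, -, hw⟩ := S.unique_diagonal e m e m (𝟙 _) (𝟙 _) he hm he hm (by simp)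
    rw [hw (m ≫ coprod.desc x y) ⟨by simp [reassoc_of% hfac, h₂], by simp [h₁]⟩,
      hw (𝟙 _) ⟨by simp, by simp⟩]
  have : IsIso m := ⟨coprod.desc x y, h₃, h₁⟩
  rw [← hfac]
  exact S.E_comp _ _ he (S.E_iso m)

end FactorisationSystem

namespace CostableFactorisationSystem

variable [HasFiniteColimits C] (S : CostableFactorisationSystem C)

attribute [local simp] coprod.inl_desc coprod.inl_desc_assoc coprod.inr_desc coprod.inr_desc_assoc

theorem M_of_isPushout {A B D P : C} {f : A ⟶ B} {g : A ⟶ D} {j : B ⟶ P} {k : D ⟶ P}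
    (h : IsPushout f g j k) (hf : S.M f) : S.M k :=
  S.costable.of_isPushout h.flip hf

theorem isPushout_map_id {A B : C} (m : A ⟶ B) (D : C) :
    IsPushout m (coprod.inl : A ⟶ A ⨿ D) coprod.inl (coprod.map m (𝟙 D)) := by
  refine ⟨⟨by simp⟩, ⟨PushoutCocone.IsColimit.mk _
    (fun s => coprod.desc s.inl (coprod.inr ≫ s.inr)) ?_ ?_ ?_⟩⟩
  · intro s
    simp
  · intro s
    have := s.condition
    ext <;> simp [this]
  · intro s n hn₁ hn₂
    ext
    · simpa using hn₁
    · simp [← hn₂]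

theorem M_coprod {A B A' B' : C} {f : A ⟶ B} {g : A' ⟶ B'} (hf : S.M f) (hg : S.M g) :
    S.M (coprod.map f g) := by
  have h₁ := S.M_of_isPushout (isPushout_map_id f A') hf
  have h₂ := S.M_of_isPushout (isPushout_map_id g B) hg
  have h : coprod.map f g = coprod.map f (𝟙 A') ≫ (coprod.braiding B A').hom ≫
      coprod.map g (𝟙 B) ≫ (coprod.braiding B' B).hom := by
    ext <;> simp
  rw [h]
  exact S.M_comp _ _ h₁ (S.M_comp _ _ (S.M_iso _) (S.M_comp _ _ h₂ (S.M_iso _)))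

theorem exists_pushout_map {Y A B A' B' P P' : C} {o : Y ⟶ A} {i : Y ⟶ B} {j : A ⟶ P} {k : B ⟶ P}
    {m : A ⟶ A'} {m' : B ⟶ B'} {j' : A' ⟶ P'} {k' : B' ⟶ P'} (h : IsPushout o i j k)
    (h' : IsPushout (o ≫ m) (i ≫ m') j' k') (hm : S.M m) (hm' : S.M m') :
    ∃ q : P ⟶ P', S.M q ∧ j ≫ q = m ≫ j' ∧ k ≫ q = m' ≫ k' := by
  have h₁ := IsPushout.of_hasPushout m j
  have h₂ := h.paste_horiz h₁
  have h₃ := IsPushout.of_hasPushout (k ≫ pushout.inr m j) m'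
  have h₄ := h₂.paste_vert h₃
  refine ⟨pushout.inr m j ≫ pushout.inl (k ≫ pushout.inr m j) m' ≫ (h₄.isoIsPushout _ _ h').hom,
    S.M_comp _ _ (S.M_of_isPushout h₁ hm) (S.M_comp _ _ (S.M_of_isPushout h₃.flip hm')
      (S.M_iso _)), ?_, ?_⟩
  · have := h₄.inl_isoIsPushout_hom _ _ h'
    rw [← Category.assoc, ← h₁.w]
    simp only [Category.assoc] at this ⊢
    rw [this]
  · have := h₄.inr_isoIsPushout_hom _ _ h'
    rw [← Category.assoc, ← Category.assoc, h₃.w]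
    simp only [Category.assoc] at this ⊢
    rw [this]

end CostableFactorisationSystem

/-- A cospan `X ⟶ N ⟵ Y` is jointly `E`-like, that is, an `(E, M)`-corelation, if its copairing
`X + Y ⟶ N` lies in `E`. -/
def Cospan.IsJointlyE [HasFiniteColimits C] (S : FactorisationSystem C) {X Y : C}
    (c : Cospan X Y) : Prop :=
  S.E (coprod.desc c.left c.right)

/-- The `E`-part of a cospan `X ⟶ N ⟵ Y`: the cospan obtained from the `E`-factor of its
copairing `X + Y ⟶ N`. -/
def Cospan.ePart [HasFiniteColimits C] (S : FactorisationSystem C) {X Y : C}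
    (c : Cospan X Y) : Cospan X Y where
  apex := S.mid (coprod.desc c.left c.right)
  left := coprod.inl ≫ S.eFactor (coprod.desc c.left c.right)
  right := coprod.inr ≫ S.eFactor (coprod.desc c.left c.right)

theorem Cospan.IsIsomorphic.isJointlyE [HasFiniteColimits C] (S : FactorisationSystem C)
    {X Y : C} {c d : Cospan X Y} (h : c.IsIsomorphic d) (hc : c.IsJointlyE S) :
    d.IsJointlyE S := by
  obtain ⟨e, h₁, h₂⟩ := h
  have := S.E_comp _ _ hc (S.E_iso e.hom)
  rwa [coprod.desc_comp, h₁, h₂] at this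

theorem coprod_desc_comp [HasFiniteColimits C] {X Y Z : C} (e : X ⨿ Y ⟶ Z) :
    coprod.desc (coprod.inl ≫ e) (coprod.inr ≫ e) = e := by
  ext <;> simp [coprod.inl_desc, coprod.inr_desc]

theorem Cospan.isJointlyE_ePart [HasFiniteColimits C] (S : FactorisationSystem C) {X Y : C}
    (c : Cospan X Y) : (c.ePart S).IsJointlyE S := by
  unfold Cospan.IsJointlyE Cospan.ePart
  rw [coprod_desc_comp]
  exact S.eFactor_mem _

/-- The property of isomorphism classes of cospans of being jointly `E`-like. -/
def CospanClass.IsJointlyE [HasFiniteColimits C] (S : FactorisationSystem C) {X Y : C} :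
    CospanClass X Y → Prop :=
  Quotient.lift (fun c => c.IsJointlyE S) (fun _ _ h =>
    propext ⟨fun hc => h.isJointlyE S hc, fun hc => (Setoid.symm h).isJointlyE S hc⟩)

/-- Isomorphism classes of `(E, M)`-corelations from `X` to `Y`. -/
def Corelation [HasFiniteColimits C] (S : FactorisationSystem C) (X Y : C) :=
  { a : CospanClass X Y // a.IsJointlyE S }

theorem Cospan.ePart_isIsomorphic [HasFiniteColimits C] (S : FactorisationSystem C) {X Y Z : C}
    (c : Cospan X Y) (e : X ⨿ Y ⟶ Z) (m : Z ⟶ c.apex) (he : S.E e) (hm : S.M m)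
    (h₁ : coprod.inl ≫ e ≫ m = c.left) (h₂ : coprod.inr ≫ e ≫ m = c.right) :
    (c.ePart S).IsIsomorphic ⟨Z, coprod.inl ≫ e, coprod.inr ≫ e⟩ := by
  obtain ⟨n, hn⟩ := S.factorisation_iso (S.eFactor_mem (coprod.desc c.left c.right))
    (S.mFactor_mem (coprod.desc c.left c.right)) he hm (by
      rw [S.eFactor_comp_mFactor, ← h₁, ← h₂, coprod_desc_comp])
  exact ⟨n, by simp [Cospan.ePart, hn], by simp [Cospan.ePart, hn]⟩

/-- The map taking the isomorphism class of a cospan to that of its `E`-part. -/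
def ePartClass [HasFiniteColimits C] (S : FactorisationSystem C) {X Y : C} :
    CospanClass X Y → Corelation S X Y :=
  Quotient.lift
    (fun c => ⟨Quotient.mk _ (c.ePart S), c.isJointlyE_ePart S⟩)
    (by
      rintro c d ⟨n, h₁, h₂⟩
      refine Subtype.ext (Quotient.sound ?_)
      refine c.ePart_isIsomorphic S (S.eFactor (coprod.desc d.left d.right))
        (S.mFactor (coprod.desc d.left d.right) ≫ n.inv) (S.eFactor_mem _)
        (S.M_comp _ _ (S.mFactor_mem _) (S.M_iso _)) ?_ ?_
      · rw [← Category.assoc (S.eFactor _), S.eFactor_comp_mFactor, coprod.inl_desc_assoc, ← h₁]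
        simp
      · rw [← Category.assoc (S.eFactor _), S.eFactor_comp_mFactor, coprod.inr_desc_assoc, ← h₂]
        simp)

namespace Corelation

open CospanClass

variable [HasFiniteColimits C]

theorem ePartClass_mk (S : FactorisationSystem C) {X Y Z N : C} {i : X ⟶ N} {o : Y ⟶ N}
    (e : X ⨿ Y ⟶ Z) (m : Z ⟶ N) (he : S.E e) (hm : S.M m)
    (h₁ : coprod.inl ≫ e ≫ m = i) (h₂ : coprod.inr ≫ e ≫ m = o) :
    (ePartClass S (CospanClass.mk i o)).1 = CospanClass.mk (coprod.inl ≫ e) (coprod.inr ≫ e) :=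
  Quotient.sound (Cospan.ePart_isIsomorphic S ⟨N, i, o⟩ e m he hm h₁ h₂)

theorem ePartClass_coe (S : FactorisationSystem C) {X Y : C} (a : Corelation S X Y) :
    ePartClass S a.1 = a := by
  obtain ⟨a, ha⟩ := a
  induction a using CospanClass.ind with
  | h N i o =>
  refine Subtype.ext ?_
  refine (ePartClass_mk S (coprod.desc i o) (𝟙 N) ha (S.M_iso _) ?_ ?_).trans ?_
  · simp [coprod.inl_desc]
  · simp [coprod.inr_desc]
  · simp [coprod.inl_desc, coprod.inr_desc]

/-- Every cospan is `m ∘ e` for a jointly `E`-like cospan `e` representing its `E`-part. -/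
theorem ind_fact (S : FactorisationSystem C) {X Y : C} {P : CospanClass X Y → Prop}
    (h : ∀ (Z N : C) (i : X ⟶ Z) (o : Y ⟶ Z) (m : Z ⟶ N), S.E (coprod.desc i o) → S.M m →
      (ePartClass S (mk (i ≫ m) (o ≫ m))).1 = mk i o → P (mk (i ≫ m) (o ≫ m)))
    (a : CospanClass X Y) : P a := by
  induction a using CospanClass.ind with
  | h N i o =>
  have he := S.eFactor_mem (coprod.desc i o)
  have hm := S.mFactor_mem (coprod.desc i o)
  have hem := S.eFactor_comp_mFactor (coprod.desc i o)
  have h₁ : (coprod.inl ≫ S.eFactor (coprod.desc i o)) ≫ S.mFactor (coprod.desc i o) = i := by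
    rw [Category.assoc, hem, coprod.inl_desc]
  have h₂ : (coprod.inr ≫ S.eFactor (coprod.desc i o)) ≫ S.mFactor (coprod.desc i o) = o := by
    rw [Category.assoc, hem, coprod.inr_desc]
  have := h _ _ (coprod.inl ≫ S.eFactor (coprod.desc i o))
    (coprod.inr ≫ S.eFactor (coprod.desc i o)) (S.mFactor (coprod.desc i o))
    (by rwa [coprod_desc_comp]) hm (ePartClass_mk S _ _ he hm (by simp) (by simp))
  rwa [h₁, h₂] at this

variable (S : CostableFactorisationSystem C)

/-- Taking the `E`-parts of two cospans does not change the `E`-part of their composite. -/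
theorem ePartClass_comp {X Y Z : C} (a : CospanClass X Y) (b : CospanClass Y Z) :
    ePartClass S.toFactorisationSystem
      (comp (ePartClass S.toFactorisationSystem a).1 (ePartClass S.toFactorisationSystem b).1) =
      ePartClass S.toFactorisationSystem (comp a b) := by
  induction a using ind_fact S.toFactorisationSystem with
  | h N N' i o m he hm ha =>
  induction b using ind_fact S.toFactorisationSystem with
  | h K K' i' o' m' he' hm' hb =>
  have h := IsPushout.of_hasPushout o i'
  have h' := IsPushout.of_hasPushout (o ≫ m) (i' ≫ m')
  obtain ⟨q, hq, hq₁, hq₂⟩ := S.exists_pushout_map h h' hm hm'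
  rw [ha, hb, comp_mk h, comp_mk h']
  have he'' := S.eFactor_mem (coprod.desc (i ≫ pushout.inl o i') (o' ≫ pushout.inr o i'))
  have hm'' := S.mFactor_mem (coprod.desc (i ≫ pushout.inl o i') (o' ≫ pushout.inr o i'))
  have hem := S.eFactor_comp_mFactor (coprod.desc (i ≫ pushout.inl o i') (o' ≫ pushout.inr o i'))
  refine Subtype.ext ?_
  rw [ePartClass_mk _ _ _ he'' hm'' (by rw [hem, coprod.inl_desc])
    (by rw [hem, coprod.inr_desc]), ePartClass_mk _ _ _ he'' (S.M_comp _ _ hm'' hq)]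
  · rw [reassoc_of% hem, coprod.inl_desc_assoc]
    simp [hq₁]
  · rw [reassoc_of% hem, coprod.inr_desc_assoc]
    simp [hq₂]

theorem desc_map_map {X Y X' Y' N N' : C} (i : X ⟶ N) (o : Y ⟶ N) (i' : X' ⟶ N') (o' : Y' ⟶ N') :
    ∃ s : (X ⨿ X') ⨿ (Y ⨿ Y') ≅ (X ⨿ Y) ⨿ (X' ⨿ Y'),
      coprod.desc (coprod.map i i') (coprod.map o o') =
        s.hom ≫ coprod.map (coprod.desc i o) (coprod.desc i' o') := by
  refine ⟨⟨coprod.desc (coprod.map coprod.inl coprod.inl) (coprod.map coprod.inr coprod.inr),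
    coprod.desc (coprod.map coprod.inl coprod.inl) (coprod.map coprod.inr coprod.inr), ?_, ?_⟩, ?_⟩
  all_goals
    ext <;> simp [coprod.inl_desc, coprod.inr_desc]

theorem isJointlyE_map (S : FactorisationSystem C) {X Y X' Y' N N' : C} {i : X ⟶ N} {o : Y ⟶ N}
    {i' : X' ⟶ N'} {o' : Y' ⟶ N'} (h : S.E (coprod.desc i o)) (h' : S.E (coprod.desc i' o')) :
    S.E (coprod.desc (coprod.map i i') (coprod.map o o')) := by
  obtain ⟨s, hs⟩ := desc_map_map i o i' o'
  rw [hs]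
  exact S.E_comp _ _ (S.E_iso _) (S.E_coprod h h')

theorem isJointlyE_tensor (S : FactorisationSystem C) {X Y X' Y' : C} {a : CospanClass X Y}
    {b : CospanClass X' Y'} (ha : a.IsJointlyE S) (hb : b.IsJointlyE S) :
    (tensor a b).IsJointlyE S := by
  induction a using CospanClass.ind with
  | h N i o =>
  induction b using CospanClass.ind with
  | h N' i' o' => exact isJointlyE_map S ha hb

/-- The composite of corelations: the `E`-part of their composite as cospans. -/
def comp {X Y Z : C} (a : Corelation S.toFactorisationSystem X Y)
    (b : Corelation S.toFactorisationSystem Y Z) : Corelation S.toFactorisationSystem X Z :=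
  ePartClass S.toFactorisationSystem (CospanClass.comp a.1 b.1)

/-- The monoidal product of corelations: their monoidal product as cospans. -/
def tensor {X Y X' Y' : C} (a : Corelation S.toFactorisationSystem X Y)
    (b : Corelation S.toFactorisationSystem X' Y') :
    Corelation S.toFactorisationSystem (X ⨿ X') (Y ⨿ Y') :=
  ⟨CospanClass.tensor a.1 b.1, isJointlyE_tensor _ a.2 b.2⟩

/-- The `E`-part of a cospan, for a costable factorisation system. -/
abbrev box {X Y : C} (a : CospanClass X Y) : Corelation S.toFactorisationSystem X Y :=
  ePartClass S.toFactorisationSystem a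

theorem box_comp {X Y Z : C} (a : CospanClass X Y) (b : CospanClass Y Z) :
    box S (CospanClass.comp a b) = comp S (box S a) (box S b) :=
  (ePartClass_comp S a b).symm

theorem box_tensor {X Y X' Y' : C} (a : CospanClass X Y) (b : CospanClass X' Y') :
    box S (CospanClass.tensor a b) = tensor S (box S a) (box S b) := by
  induction a using ind_fact S.toFactorisationSystem with
  | h N K i o m he hm ha =>
  induction b using ind_fact S.toFactorisationSystem with
  | h N' K' i' o' m' he' hm' hb =>
  refine Subtype.ext ?_
  simp only [box, tensor]
  rw [ha, hb, tensor_mk, tensor_mk,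
    ePartClass_mk _ _ _ (isJointlyE_map _ he he') (S.M_coprod hm hm')]
  · simp [coprod.inl_desc, coprod.inr_desc]
  · simp [coprod.inl_desc]
  · simp [coprod.inr_desc]

theorem exists_box {X Y : C} (a : Corelation S.toFactorisationSystem X Y) :
    ∃ b, box S b = a := ⟨a.1, ePartClass_coe _ a⟩

end Corelation

/-! ### The hypergraph category of corelations -/

/-- The objects of the category of corelations in `C`: the objects of `C`. -/
@[ext]
structure CorelCat [HasFiniteColimits C] (S : CostableFactorisationSystem C) where
  of ::
  as : C

namespace CorelCat

open Corelation

variable [HasFiniteColimits C] (S : CostableFactorisationSystem C)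

instance : Category.{max u v} (CorelCat S) where
  Hom X Y := Corelation S.toFactorisationSystem X.as Y.as
  id X := box S (CospanClass.fwd (𝟙 X.as))
  comp a b := comp S a b
  id_comp {X Y} a := by
    obtain ⟨a, rfl⟩ := exists_box S a
    exact (box_comp S _ _).symm.trans (congrArg (box S) (CospanClass.id_comp a))
  comp_id {X Y} a := by
    obtain ⟨a, rfl⟩ := exists_box S a
    exact (box_comp S _ _).symm.trans (congrArg (box S) (CospanClass.comp_id a))
  assoc {W X Y Z} a b c := by
    obtain ⟨a, rfl⟩ := exists_box S a
    obtain ⟨b, rfl⟩ := exists_box S b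
    obtain ⟨c, rfl⟩ := exists_box S c
    rw [← box_comp, ← box_comp, ← box_comp, ← box_comp, CospanClass.assoc]

/-- The map `□` from cospans to corelations, which takes each object to itself and (the class of)
a cospan to (the class of) its `E`-part. -/
def boxMap {X Y : CospanCat C} (a : X ⟶ Y) : (of X.as : CorelCat S) ⟶ of Y.as :=
  ePartClass S.toFactorisationSystem a

theorem congrArg_boxMap {X Y : CospanCat C} {a b : X ⟶ Y} (h : a = b) :
    boxMap S a = boxMap S b := by rw [h]

/-- The `E`-part of an isomorphism in the category of cospans. -/
def boxIso {X Y : CospanCat C} (e : X ≅ Y) : (of X.as : CorelCat S) ≅ of Y.as where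
  hom := box S e.hom
  inv := box S e.inv
  hom_inv_id := (box_comp S _ _).symm.trans (congrArg (box S) e.hom_inv_id)
  inv_hom_id := (box_comp S _ _).symm.trans (congrArg (box S) e.inv_hom_id)

/-- The object of the category of cospans underlying an object of the category of corelations. -/
abbrev toCospanCat {S : CostableFactorisationSystem C} (X : CorelCat S) : CospanCat C :=
  CospanCat.of X.as

instance : MonoidalCategoryStruct (CorelCat S) where
  tensorObj X Y := of (X.as ⨿ Y.as)
  whiskerLeft X _ _ a := tensor S (box S (CospanClass.fwd (𝟙 X.as))) a
  whiskerRight a Y := tensor S a (box S (CospanClass.fwd (𝟙 Y.as)))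
  tensorHom a b := tensor S a b
  tensorUnit := of (⊥_ C)
  associator X Y Z := boxIso S (α_ X.toCospanCat Y.toCospanCat Z.toCospanCat)
  leftUnitor X := boxIso S (λ_ X.toCospanCat)
  rightUnitor X := boxIso S (ρ_ X.toCospanCat)

variable {S} in
theorem exists_map {X Y : CorelCat S} (f : X ⟶ Y) :
    ∃ a : X.toCospanCat ⟶ Y.toCospanCat, boxMap S a = f := exists_box S f

theorem map_comp {X Y Z : CospanCat C} (a : X ⟶ Y) (b : Y ⟶ Z) :
    boxMap S (a ≫ b) = boxMap S a ≫ boxMap S b := box_comp S a b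

theorem map_id (X : CospanCat C) : boxMap S (𝟙 X) = 𝟙 _ := rfl

theorem map_tensor {X Y X' Y' : CospanCat C} (a : X ⟶ Y) (b : X' ⟶ Y') :
    boxMap S (a ⊗ₘ b) =
      (boxMap S a ⊗ₘ boxMap S b : of X.as ⊗ of X'.as ⟶ of Y.as ⊗ of Y'.as) :=
  box_tensor S a b

instance : MonoidalCategory (CorelCat S) :=
  MonoidalCategory.ofTensorHom
    (id_tensorHom_id := fun X Y => (map_tensor S (𝟙 X.toCospanCat) (𝟙 Y.toCospanCat)).symm.trans
      (congrArg_boxMap S (id_tensorHom_id X.toCospanCat Y.toCospanCat)))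
    (id_tensorHom := fun _ _ _ _ => rfl)
    (tensorHom_id := fun _ _ => rfl)
    (tensorHom_comp_tensorHom := by
      intro X₁ Y₁ Z₁ X₂ Y₂ Z₂ f₁ f₂ g₁ g₂
      obtain ⟨f₁, rfl⟩ := exists_map f₁
      obtain ⟨f₂, rfl⟩ := exists_map f₂
      obtain ⟨g₁, rfl⟩ := exists_map g₁
      obtain ⟨g₂, rfl⟩ := exists_map g₂
      have := congrArg_boxMap S (tensorHom_comp_tensorHom f₁ f₂ g₁ g₂)
      rwa [map_comp, map_tensor, map_tensor, map_tensor, map_comp, map_comp] at this)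
    (associator_naturality := by
      intro X₁ X₂ X₃ Y₁ Y₂ Y₃ f₁ f₂ f₃
      obtain ⟨f₁, rfl⟩ := exists_map f₁
      obtain ⟨f₂, rfl⟩ := exists_map f₂
      obtain ⟨f₃, rfl⟩ := exists_map f₃
      have := congrArg_boxMap S (associator_naturality f₁ f₂ f₃)
      rwa [map_comp, map_comp, map_tensor, map_tensor, map_tensor, map_tensor] at this)
    (leftUnitor_naturality := by
      intro X Y f
      obtain ⟨f, rfl⟩ := exists_map f
      have := congrArg_boxMap S (leftUnitor_naturality f)
      rwa [← id_tensorHom, map_comp, map_comp, map_tensor] at this)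
    (rightUnitor_naturality := by
      intro X Y f
      obtain ⟨f, rfl⟩ := exists_map f
      have := congrArg_boxMap S (rightUnitor_naturality f)
      rwa [← tensorHom_id, map_comp, map_comp, map_tensor] at this)
    (pentagon := by
      intro W X Y Z
      have := congrArg_boxMap S
        (pentagon W.toCospanCat X.toCospanCat Y.toCospanCat Z.toCospanCat)
      rwa [← id_tensorHom, ← tensorHom_id, map_comp, map_comp, map_comp, map_tensor,
        map_tensor] at this)
    (triangle := by
      intro X Y
      have := congrArg_boxMap S (triangle X.toCospanCat Y.toCospanCat)
      rwa [← id_tensorHom, ← tensorHom_id, map_comp, map_tensor, map_tensor] at this)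

theorem map_whiskerLeft (X : CospanCat C) {Y Y' : CospanCat C} (a : Y ⟶ Y') :
    boxMap S (X ◁ a) = (of X.as ◁ boxMap S a : of X.as ⊗ of Y.as ⟶ of X.as ⊗ of Y'.as) :=
  box_tensor S _ a

theorem map_whiskerRight {X X' : CospanCat C} (a : X ⟶ X') (Y : CospanCat C) :
    boxMap S (a ▷ Y) = (boxMap S a ▷ of Y.as : of X.as ⊗ of Y.as ⟶ of X'.as ⊗ of Y.as) :=
  box_tensor S a _

instance : SymmetricCategory (CorelCat S) where
  braiding X Y := boxIso S (β_ X.toCospanCat Y.toCospanCat)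
  braiding_naturality_right X _ _ f := by
    obtain ⟨f, rfl⟩ := exists_map f
    have := congrArg_boxMap S
      (BraidedCategory.braiding_naturality_right X.toCospanCat f)
    rwa [map_comp, map_comp, map_whiskerLeft, map_whiskerRight] at this
  braiding_naturality_left f Z := by
    obtain ⟨f, rfl⟩ := exists_map f
    have := congrArg_boxMap S
      (BraidedCategory.braiding_naturality_left f Z.toCospanCat)
    rwa [map_comp, map_comp, map_whiskerLeft, map_whiskerRight] at this
  hexagon_forward X Y Z := by
    have := congrArg_boxMap S
      (BraidedCategory.hexagon_forward X.toCospanCat Y.toCospanCat Z.toCospanCat)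
    rwa [map_comp, map_comp, map_comp, map_comp, map_whiskerLeft, map_whiskerRight] at this
  hexagon_reverse X Y Z := by
    have := congrArg_boxMap S
      (BraidedCategory.hexagon_reverse X.toCospanCat Y.toCospanCat Z.toCospanCat)
    rwa [map_comp, map_comp, map_comp, map_comp, map_whiskerLeft, map_whiskerRight] at this
  symmetry X Y := by
    have := congrArg_boxMap S
      (SymmetricCategory.symmetry X.toCospanCat Y.toCospanCat)
    rwa [map_comp] at this

open HypergraphCategory in
/-- The Frobenius structure on an object of the category of corelations, given by the `E`-parts
of the structure maps in the category of cospans. -/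
abbrev frobeniusStruct (X : CorelCat S) : SpecialCommFrobenius X where
  mul := boxMap S (frobenius X.toCospanCat).mul
  one := boxMap S (frobenius X.toCospanCat).one
  comul := boxMap S (frobenius X.toCospanCat).comul
  counit := boxMap S (frobenius X.toCospanCat).counit
  one_mul := by
    have := congrArg_boxMap S (frobenius X.toCospanCat).one_mul
    rwa [map_comp, map_whiskerRight] at this
  mul_one := by
    have := congrArg_boxMap S (frobenius X.toCospanCat).mul_one
    rwa [map_comp, map_whiskerLeft] at this
  mul_assoc := by
    have := congrArg_boxMap S (frobenius X.toCospanCat).mul_assoc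
    rwa [map_comp, map_comp, map_comp, map_whiskerLeft, map_whiskerRight] at this
  counit_comul := by
    have := congrArg_boxMap S (frobenius X.toCospanCat).counit_comul
    rwa [map_comp, map_whiskerRight] at this
  comul_counit := by
    have := congrArg_boxMap S (frobenius X.toCospanCat).comul_counit
    rwa [map_comp, map_whiskerLeft] at this
  comul_assoc := by
    have := congrArg_boxMap S (frobenius X.toCospanCat).comul_assoc
    rwa [map_comp, map_comp, map_comp, map_whiskerLeft, map_whiskerRight] at this
  braiding_mul := by
    have := congrArg_boxMap S (frobenius X.toCospanCat).braiding_mul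
    rwa [map_comp] at this
  comul_braiding := by
    have := congrArg_boxMap S (frobenius X.toCospanCat).comul_braiding
    rwa [map_comp] at this
  frobenius_left := by
    have := congrArg_boxMap S (frobenius X.toCospanCat).frobenius_left
    rwa [map_comp, map_comp, map_comp, map_whiskerLeft, map_whiskerRight] at this
  frobenius_right := by
    have := congrArg_boxMap S (frobenius X.toCospanCat).frobenius_right
    rwa [map_comp, map_comp, map_comp, map_whiskerLeft, map_whiskerRight] at this
  special := by
    have := congrArg_boxMap S (frobenius X.toCospanCat).special
    rwa [map_comp] at this

theorem map_tensorμ (X Y Z W : CospanCat C) :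
    boxMap S (tensorμ X Y Z W) =
      tensorμ (of X.as : CorelCat S) (of Y.as) (of Z.as) (of W.as) := by
  unfold tensorμ
  rw [map_comp, map_comp, map_comp, map_comp, map_whiskerLeft, map_whiskerLeft, map_whiskerLeft,
    map_whiskerRight]
  rfl

instance : HypergraphCategory (CorelCat S) where
  frobenius := frobeniusStruct S
  mul_tensor X Y := by
    have := congrArg_boxMap S (HypergraphCategory.mul_tensor X.toCospanCat Y.toCospanCat)
    rwa [map_comp, map_tensorμ, map_tensor] at this
  one_tensor X Y := by
    have := congrArg_boxMap S (HypergraphCategory.one_tensor X.toCospanCat Y.toCospanCat)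
    rwa [map_comp, map_tensor] at this
  comul_tensor X Y := by
    have := congrArg_boxMap S (HypergraphCategory.comul_tensor X.toCospanCat Y.toCospanCat)
    rwa [map_comp, map_tensorμ, map_tensor] at this
  counit_tensor X Y := by
    have := congrArg_boxMap S (HypergraphCategory.counit_tensor X.toCospanCat Y.toCospanCat)
    rwa [map_comp, map_tensor] at this

end CorelCat

end

end CospanCorel

/-! The theorem reduces to two facts: taking `E`-parts commutes with composition and with the
monoidal product. Identities, coherence maps and Frobenius maps of corelations are by definition the
`E`-parts of those of cospans, so `□` preserves them at once.

Composition (`ePartClass_comp`) is where costability enters. Given two composable cospans, each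
equal to its `E`-part followed by a map of `M` on the apex, there is a comparison map `q` from the
pushout that composes the `E`-parts to the pushout that composes the original cospans. By pasting
squares, `q` is a composite of pushouts of the two `M`-maps and an isomorphism, hence lies in `M`
(`exists_pushout_map`). If `m ∘ e` factors the copairing of the composite of the `E`-parts, then `(q
∘ m) ∘ e` factors that of the original composite. Since factorisations are unique up to isomorphism
(`factorisation_iso`), the two composites have the same `E`-part.

For the monoidal product (`box_tensor`), both classes are closed under coproducts. For `E` this
holds in any factorisation system: the diagonal fillers out of the two summands assemble into an
inverse of the `M`-factor of `f + g` (`E_coprod`). For `M` it uses costability again, because `m +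
1` is the pushout of `m` along a coprojection (`M_coprod`). So the coproduct of two factorisations
is a factorisation of the coproduct, up to the rearrangement of summands in `desc_map_map`.

Every corelation is its own `E`-part, so `□` is also full. This is how the axioms of the hypergraph
category of corelations are inherited from cospans, and it leaves only identity coherence maps to be
checked here. -/

namespace CospanCorel

variable {C : Type u} [Category.{v} C] [HasFiniteColimits C]

/-! ### The functor `□` and its identity coherence maps. -/

namespace CorelCat

variable (S : CostableFactorisationSystem C)

/-- The functor from cospans to corelations which takes each object to itself and each cospan to
its `E`-part. -/
noncomputable def boxFunctor : CospanCat C ⥤ CorelCat S where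
  obj X := of X.as
  map a := boxMap S a
  -- True by definition: the `E`-part of an identity cospan is the identity corelation. It need not
  -- be represented by the identity cospan itself, since `[1, 1]` need not lie in `E`.
  map_id := map_id S
  -- The substantial half of functoriality, which rests on the stability of `M` under pushout.
  map_comp := map_comp S

/-- The strong monoidal structure on `boxFunctor` whose coherence maps are identities. -/
noncomputable def boxFunctorCoreMonoidal : (boxFunctor S).CoreMonoidal where
  εIso := Iso.refl (𝟙_ (CorelCat S))
  -- An identity can serve here because both categories tensor objects by the same chosen coproduct
  -- `X.as ⨿ Y.as`; likewise both units are the same initial object.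
  μIso X Y := Iso.refl (of X.as ⊗ of Y.as : CorelCat S)
  -- With identity components, naturality in each variable says exactly that `□` commutes with
  -- whiskering, a special case of `box_tensor`.
  μIso_hom_natural_left f X' :=
    (Category.comp_id _).trans ((map_whiskerRight S f X').symm.trans (Category.id_comp _).symm)
  μIso_hom_natural_right X' f :=
    (Category.comp_id _).trans ((map_whiskerLeft S X' f).symm.trans (Category.id_comp _).symm)
  associativity X Y Z := by
    -- The image under `□` of the cospan associator is by definition the associator of corelations.
    -- Once it is written so, and the coherence maps appear as identities, both sides collapse to
    -- that associator. The unitors below are treated in the same way.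
    change (𝟙 (of X.as ⊗ of Y.as : CorelCat S) ▷ of Z.as) ≫
        𝟙 ((of X.as ⊗ of Y.as) ⊗ of Z.as : CorelCat S) ≫ (α_ (of X.as) (of Y.as) (of Z.as)).hom =
      (α_ (of X.as) (of Y.as) (of Z.as)).hom ≫
        (of X.as ◁ 𝟙 (of Y.as ⊗ of Z.as : CorelCat S)) ≫
          𝟙 (of X.as ⊗ of Y.as ⊗ of Z.as : CorelCat S)
    simp
  left_unitality X := by
    change (λ_ (of X.as : CorelCat S)).hom = (𝟙 (𝟙_ (CorelCat S)) ▷ of X.as) ≫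
      𝟙 (𝟙_ (CorelCat S) ⊗ of X.as) ≫ (λ_ (of X.as)).hom
    simp
  right_unitality X := by
    change (ρ_ (of X.as : CorelCat S)).hom = (of X.as ◁ 𝟙 (𝟙_ (CorelCat S))) ≫
      𝟙 (of X.as ⊗ 𝟙_ (CorelCat S)) ≫ (ρ_ (of X.as)).hom
    simp

noncomputable instance : (boxFunctor S).Braided where
  toMonoidal := (boxFunctorCoreMonoidal S).toMonoidal
  -- The braiding of corelations is the `E`-part of the braiding of cospans, so both sides are this
  -- braiding composed with an identity.
  braided _ _ := (Category.id_comp _).trans (Category.comp_id _).symm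

theorem boxFunctor_isStrictHypergraphFunctor : IsStrictHypergraphFunctor (boxFunctor S) where
  -- The Frobenius maps of corelations are the images under `boxMap` of those of cospans. Each law
  -- therefore only removes an identity: on the left for `μ` and `ε`, on the right for their
  -- inverses `δ` and `η`.
  mul _ := (Category.id_comp _).symm
  one _ := (Category.id_comp _).symm
  comul _ := (Category.comp_id _).symm
  counit _ := (Category.comp_id _).symm
  unit_strict := ⟨rfl, rfl⟩
  tensor_strict _ _ := ⟨rfl, rfl⟩

end CorelCat

end CospanCorel

/-- As `F` is quantified existentially, `F.obj X` is known to be `of X.as` only through the equation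
`hobj X`. The `eqToHom` factors transport `boxMap S a` along these equations, so that the action of
`F` on morphisms can be stated. -/
theorem mainTheorem6 {C : Type u} [Category.{v} C] [HasFiniteColimits C]
    (S : CospanCorel.CostableFactorisationSystem C) :
    ∃ (F : CospanCorel.CospanCat C ⥤ CospanCorel.CorelCat S) (_ : F.Braided)
      (hobj : ∀ X : CospanCorel.CospanCat C, F.obj X = CospanCorel.CorelCat.of X.as),
      (∀ (X Y : CospanCorel.CospanCat C) (a : X ⟶ Y),
        F.map a = eqToHom (hobj X) ≫ CospanCorel.CorelCat.boxMap S a ≫ eqToHom (hobj Y).symm) ∧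
      CospanCorel.IsStrictHypergraphFunctor F :=
  ⟨CospanCorel.CorelCat.boxFunctor S, inferInstance, fun _ => rfl,
    -- For `boxFunctor` the equations on objects hold by `rfl`, so both transports are identities.
    fun _ _ _ => ((Category.id_comp _).trans (Category.comp_id _)).symm,
    CospanCorel.CorelCat.boxFunctor_isStrictHypergraphFunctor S⟩
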